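/- Let $D$ be a division ring whose center $F$ is a finite field with $q$ elements, and let $n$ be an integer with $q > n \ge 2$. Write $\mathrm{M}_n(D)$ for the ring of $n\times n$ matrices over $D$, and $[X,Y] := XY - YX$ for $X, Y \in \mathrm{M}_n(D)$. Then for every $A \in \mathrm{M}_n(D)$ there exist $X, Y, Z, W \in \mathrm{M}_n(D)$ such that $$A = [X,Y]\,[Z,W]$$ and $[X,Y]$ is invertible in $\mathrm{M}_n(D)$. -/

import Mathlib

/-! A matrix with zero diagonal is a commutator with a diagonal matrix of distinct central entries,
available since `n < q`. It is thus enough to write some conjugate of A as S * T with S an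
invertible commutator and T of zero diagonal. A central scalar factors through the permutation
matrix of a derangement. Any other A is conjugate to some B whose diagonal vanishes off one index i
(`exists_isConj_diag_zero_off`), so S only has to make S⁻¹ * B vanish at (i, i) without spoiling the
rest of the diagonal.

Trace zero characterizes commutators over the center but not obviously over D, so S is chosen with
central entries, up to a diagonal conjugation. -/

namespace Matrix

variable {ι R : Type*} [Fintype ι] [DecidableEq ι]

/-! ### Conjugation to an almost zero diagonal -/

/-- Conjugation by the elementary matrix `1 + t E_ij`, in coordinates. -/
theorem exists_isConj_elementary [Ring R] (A : Matrix ι ι R) {i j : ι} (hij : i ≠ j) (t : R) :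
    ∃ B, IsConj A B ∧ ∀ a b, B a b = A a b + (if a = i then t * A j b else 0)
      - (if b = j then A a i * t else 0) - (if a = i ∧ b = j then t * A j i * t else 0) := by
  have h0 : single i j t * single i j t = 0 := single_mul_single_of_ne _ _ _ _ hij.symm _
  let U : (Matrix ι ι R)ˣ :=
    ⟨1 + single i j t, 1 - single i j t, by noncomm_ring; simp [h0], by noncomm_ring; simp [h0]⟩
  refine ⟨U * A * ((U⁻¹ : (Matrix ι ι R)ˣ) : Matrix ι ι R), ⟨U, by simp [SemiconjBy]⟩, fun a b => ?_⟩
  have h1 : ∀ (M : Matrix ι ι R) (a b), (single i j t * M) a b = if a = i then t * M j b else 0 := by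
    intro M a b
    split_ifs with h
    · subst h; simp
    · exact single_mul_apply_of_ne _ _ _ _ _ h M
  have h2 : ∀ (M : Matrix ι ι R) (a b), (M * single i j t) a b = if b = j then M a i * t else 0 := by
    intro M a b
    split_ifs with h
    · subst h; simp
    · exact mul_single_apply_of_ne _ _ _ _ _ h M
  have e : (U * A * ((U⁻¹ : (Matrix ι ι R)ˣ) : Matrix ι ι R))
      = A + single i j t * A - A * single i j t - single i j t * (A * single i j t) := by
    change (1 + single i j t) * A * (1 - single i j t) = _
    noncomm_ring
  rw [e]
  simp only [sub_apply, add_apply, h1, h2]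
  by_cases ha : a = i <;> by_cases hb : b = j <;> simp [ha, hb, mul_assoc]

/-- The block of `A` on the index set `S` is a central scalar matrix. -/
def IsScalarOn [Ring R] (A : Matrix ι ι R) (S : Finset ι) : Prop :=
  ∃ c ∈ Subring.center R, ∀ i ∈ S, ∀ j ∈ S, A i j = if i = j then c else 0

/-- If the block is diagonal, conjugating by 1 + t E_ij creates the entry t * A j j - A i i * t.
Were this always zero, t = 1 would make the diagonal constant, and general t would make it central.
-/
theorem exists_isConj_offDiag_ne_zero [Ring R] (A : Matrix ι ι R) {S : Finset ι}
    (hS : 2 ≤ S.card) (hA : ¬ A.IsScalarOn S) :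
    ∃ B, IsConj A B ∧ (∀ a ∉ S, B a a = A a a) ∧ ∃ i ∈ S, ∃ j ∈ S, i ≠ j ∧ B j i ≠ 0 := by
  by_cases h : ∃ i ∈ S, ∃ j ∈ S, i ≠ j ∧ A j i ≠ 0
  · exact ⟨A, IsConj.refl A, fun _ _ => rfl, h⟩
  push Not at h
  have key : ∃ i ∈ S, ∃ j ∈ S, i ≠ j ∧ ∃ t : R, t * A j j - A i i * t ≠ 0 := by
    by_contra hc
    push Not at hc
    obtain ⟨k, hk, l, hl, hkl⟩ := Finset.one_lt_card.1 hS
    have e : ∀ i ∈ S, A i i = A k k := by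
      intro i hi
      by_cases hik : i = k
      · rw [hik]
      · have := hc i hi k hk hik 1
        simpa [sub_eq_zero, eq_comm] using this
    refine hA ⟨A k k, Subring.mem_center_iff.2 fun t => ?_, fun i hi j hj => ?_⟩
    · have := hc k hk l hl hkl t
      rwa [e l hl, sub_eq_zero] at this
    · split_ifs with hij
      · rw [← hij, e i hi]
      · exact h j hj i hi (Ne.symm hij)
  obtain ⟨i, hi, j, hj, hij, t, ht⟩ := key
  obtain ⟨B, hB, hBe⟩ := exists_isConj_elementary A hij t
  refine ⟨B, hB, fun a ha => ?_, j, hj, i, hi, hij.symm, ?_⟩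
  · have h1 : a ≠ i := fun h => ha (h ▸ hi)
    have h2 : a ≠ j := fun h => ha (h ▸ hj)
    simp [hBe, h1, h2]
  · simpa [hBe, h j hj i hi hij.symm, h i hi j hj hij] using ht

variable {D : Type*} [DivisionRing D]

theorem exists_isConj_diag_zero_erase (A : Matrix ι ι D) {S : Finset ι}
    (hS : 2 ≤ S.card) (hA : ¬ A.IsScalarOn S) :
    ∃ B, IsConj A B ∧ (∀ a ∉ S, B a a = A a a) ∧
      ∃ i ∈ S, B i i = 0 ∧ (2 ≤ (S.erase i).card → ¬ B.IsScalarOn (S.erase i)) := by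
  obtain ⟨B, hB, hBd, i, hi, j, hj, hij, hne⟩ := exists_isConj_offDiag_ne_zero A hS hA
  -- Adding this multiple of row j to row i clears the (i, i) entry.
  obtain ⟨C, hC, hCe⟩ := exists_isConj_elementary B hij (-(B i i * (B j i)⁻¹))
  have hCd : ∀ a ∉ S, C a a = A a a := fun a ha => by
    have h1 : a ≠ i := fun h => ha (h ▸ hi)
    have h2 : a ≠ j := fun h => ha (h ▸ hj)
    simp [hCe, h1, h2, hBd a ha]
  have hCi : C i i = 0 := by simp [hCe, hij, hne]
  have hCj : C j i ≠ 0 := by simpa [hCe, hij, hij.symm] using hne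
  -- If the remaining block became scalar, column i is used to spoil it: clear C k i, then conjugate
  -- by 1 + E_ik. This keeps (i, i) zero and puts -E j i ≠ 0 at (j, k).
  by_cases hs : 2 ≤ (S.erase i).card ∧ C.IsScalarOn (S.erase i)
  swap
  · exact ⟨C, hB.trans hC, hCd, i, hi, hCi, fun h h' => hs ⟨h, h'⟩⟩
  obtain ⟨hcard, c, hc, hsc⟩ := hs
  have hj' : j ∈ S.erase i := Finset.mem_erase.2 ⟨hij.symm, hj⟩
  obtain ⟨k, hk', hkj⟩ := Finset.exists_mem_ne hcard j
  have hki : k ≠ i := (Finset.mem_erase.1 hk').1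
  have hk : k ∈ S := (Finset.mem_erase.1 hk').2
  obtain ⟨E, hE, hEe⟩ := exists_isConj_elementary C hkj (-(C k i * (C j i)⁻¹))
  have hEd : ∀ a ∉ S, E a a = A a a := fun a ha => by
    have h1 : a ≠ k := fun h => ha (h ▸ hk)
    have h2 : a ≠ j := fun h => ha (h ▸ hj)
    simp [hEe, h1, h2, hCd a ha]
  have hEi : E i i = 0 := by simp [hEe, hki.symm, hij, hCi]
  have hEj : E j i ≠ 0 := by simpa [hEe, hij, hkj.symm] using hCj
  have hEk : E k i = 0 := by simp [hEe, hij, hCj]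
  have hEjk : E j k = 0 := by simp [hEe, hkj, hkj.symm, hsc j hj' k hk']
  obtain ⟨G, hG, hGe⟩ := exists_isConj_elementary E hki.symm 1
  refine ⟨G, ((hB.trans hC).trans hE).trans hG, fun a ha => ?_, i, hi, ?_, ?_⟩
  · have h1 : a ≠ i := fun h => ha (h ▸ hi)
    have h2 : a ≠ k := fun h => ha (h ▸ hk)
    simp [hGe, h1, h2, hEd a ha]
  · simp [hGe, hki.symm, hEi, hEk]
  · rintro - ⟨c', -, h'⟩
    have := h' j hj' k hk'
    simp [hGe, hkj.symm, hij.symm, hEjk, hEj] at this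

/-- A matrix over a division ring whose block on `S` is not a central scalar matrix is conjugate
to one whose diagonal vanishes at all but one index of `S`. -/
theorem exists_isConj_diag_zero_off (S : Finset ι) (hne : S.Nonempty) (A : Matrix ι ι D)
    (hA : 2 ≤ S.card → ¬ A.IsScalarOn S) :
    ∃ B, IsConj A B ∧ (∀ a ∉ S, B a a = A a a) ∧ ∃ i ∈ S, ∀ j ∈ S, j ≠ i → B j j = 0 := by
  induction S using Finset.strongInduction generalizing A with
  | H S ih =>
    by_cases hS : 2 ≤ S.card
    · obtain ⟨B, hB, hBd, i, hi, hBi, hs⟩ := exists_isConj_diag_zero_erase A hS (hA hS)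
      have hne' : (S.erase i).Nonempty := by
        rw [← Finset.card_pos, Finset.card_erase_of_mem hi]; omega
      obtain ⟨C, hC, hCd, k, hk, hCk⟩ := ih _ (Finset.erase_ssubset hi) hne' B hs
      refine ⟨C, hB.trans hC, fun a ha => ?_, k, (Finset.mem_erase.1 hk).2, fun j hj hjk => ?_⟩
      · rw [hCd a (fun h => ha (Finset.mem_erase.1 h).2), hBd a ha]
      · by_cases hji : j = i
        · rw [hji, hCd i (by simp), hBi]
        · exact hCk j (Finset.mem_erase.2 ⟨hji, hj⟩) hjk
    · obtain ⟨i, hi⟩ := hne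
      refine ⟨A, IsConj.refl A, fun _ _ => rfl, i, hi, fun j hj hji => absurd ?_ hS⟩
      exact Finset.one_lt_card.2 ⟨j, hj, i, hi, hji⟩

/-! ### Criteria for being a commutator -/

/-- Additive commutators in a matrix ring. -/
def IsAddCommutator [Ring R] (A : Matrix ι ι R) : Prop :=
  ∃ X Y : Matrix ι ι R, A = X * Y - Y * X

theorem IsAddCommutator.of_isConj [Ring R] {A B : Matrix ι ι R} (h : IsConj A B)
    (hA : A.IsAddCommutator) : B.IsAddCommutator := by
  obtain ⟨U, hU⟩ := h
  obtain ⟨X, Y, rfl⟩ := hA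
  have hB : B = U * (X * Y - Y * X) * (U⁻¹ : (Matrix ι ι R)ˣ) := by
    rw [hU.eq, mul_assoc, Units.mul_inv, mul_one]
  refine ⟨U * X * (U⁻¹ : (Matrix ι ι R)ˣ), U * Y * (U⁻¹ : (Matrix ι ι R)ˣ), ?_⟩
  have e : ∀ M N : Matrix ι ι R, U * M * (U⁻¹ : (Matrix ι ι R)ˣ) * (U * N * (U⁻¹ : (Matrix ι ι R)ˣ))
      = U * (M * N) * (U⁻¹ : (Matrix ι ι R)ˣ) := fun M N => by
    simp [mul_assoc]
  rw [hB, e, e, mul_sub, sub_mul]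

omit [DecidableEq ι] in
theorem IsAddCommutator.map {T : Type*} [Ring R] [Ring T] (f : R →+* T) {A : Matrix ι ι R}
    (hA : A.IsAddCommutator) : (A.map f).IsAddCommutator := by
  obtain ⟨X, Y, rfl⟩ := hA
  refine ⟨X.map f, Y.map f, ?_⟩
  rw [← Matrix.map_mul, ← Matrix.map_mul, Matrix.map_sub]
  exact fun a b => map_sub f a b

theorem isAddCommutator_of_diag_zero (f : ι → Subring.center D)
    (hf : Function.Injective f) (A : Matrix ι ι D) (hA : ∀ i, A i i = 0) : A.IsAddCommutator := by
  refine ⟨diagonal fun i => (f i : D), of fun i j => ((f i : D) - f j)⁻¹ * A i j, ?_⟩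
  ext i j
  rw [sub_apply, diagonal_mul, mul_diagonal, of_apply]
  by_cases hij : i = j
  · simp [hij, hA]
  · have h : (f i : D) - f j ≠ 0 := sub_ne_zero.2 fun h => hij (hf (Subtype.ext h))
    rw [Subring.mem_center_iff.1 (f j).2 _, ← sub_mul, mul_inv_cancel_left₀ h]

/-- If the characteristic divides the size, the identity matrix is a commutator. -/
theorem isAddCommutator_one_of_natCast_eq_zero [Ring R] {n : ℕ} (hn : (n : R) = 0) :
    (1 : Matrix (Fin n) (Fin n) R).IsAddCommutator := by
  -- A shift against a weighted shift: the diagonal of the commutator is (i + 1) - i, the last entry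
  -- being 0 - (n - 1) = 1.
  refine ⟨of fun i j => if (j : ℕ) = i + 1 then 1 else 0,
    of fun i j => if (i : ℕ) = j + 1 then ((i : ℕ) : R) else 0, ?_⟩
  ext i j
  have h1 : ∑ k : Fin n, (if (k : ℕ) = i + 1 then (1 : R) else 0) *
      (if (k : ℕ) = j + 1 then ((k : ℕ) : R) else 0) = if i = j then ((i : ℕ) : R) + 1 else 0 := by
    by_cases hi : (i : ℕ) + 1 < n
    · rw [Finset.sum_eq_single ⟨i + 1, hi⟩]
      · simp [Fin.ext_iff]
      · intro b _ hb
        rw [if_neg fun h => hb (Fin.ext h), zero_mul]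
      · simp
    · rw [Finset.sum_eq_zero]
      · split_ifs with hij
        · have : (i : ℕ) + 1 = n := by omega
          rw [← Nat.cast_succ, Nat.succ_eq_add_one, this, hn]
        · rfl
      · intro k _
        rw [if_neg (by omega), zero_mul]
  have h2 : ∑ k : Fin n, (if (i : ℕ) = k + 1 then ((i : ℕ) : R) else 0) *
      (if (j : ℕ) = k + 1 then (1 : R) else 0) = if i = j then ((i : ℕ) : R) else 0 := by
    by_cases hi : (i : ℕ) = 0
    · rw [Finset.sum_eq_zero]
      · simp [hi]
      · intro k _
        rw [if_neg (by omega), zero_mul]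
    · rw [Finset.sum_eq_single ⟨i - 1, by omega⟩]
      · have e : (i : ℕ) = i - 1 + 1 := by omega
        simp only [← e, if_true, Fin.ext_iff]
        simp [eq_comm]
      · intro b _ hb
        rw [if_neg fun h => hb (Fin.ext (by simp; omega)), zero_mul]
      · simp
  simp only [sub_apply, mul_apply, of_apply, h1, h2]
  by_cases hij : i = j <;> simp [hij, one_apply]

/-- Over a field with at least `n` elements, trace zero matrices of size `n` are commutators. -/
theorem isAddCommutator_of_trace_eq_zero {K : Type*} [Field K] {n : ℕ} (hn : 0 < n) (f : Fin n → K)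
    (hf : Function.Injective f) (A : Matrix (Fin n) (Fin n) K) (hA : A.trace = 0) :
    A.IsAddCommutator := by
  have hne : (Finset.univ : Finset (Fin n)).Nonempty := ⟨⟨0, hn⟩, Finset.mem_univ _⟩
  by_cases h : A.IsScalarOn Finset.univ
  · obtain ⟨c, -, hc⟩ := h
    have e : A = c • (1 : Matrix (Fin n) (Fin n) K) := by
      ext i j
      simp [hc, one_apply]
    by_cases hc0 : c = 0
    · exact ⟨0, 0, by simp [e, hc0]⟩
    · have : (n : K) = 0 := by simpa [e, hc0] using hA
      obtain ⟨X, Y, h1⟩ := isAddCommutator_one_of_natCast_eq_zero this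
      exact ⟨c • X, Y, by rw [e, h1, smul_sub, smul_mul_assoc, mul_smul_comm]⟩
  · obtain ⟨B, hB, -, i, -, hi⟩ := exists_isConj_diag_zero_off Finset.univ hne A fun _ => h
    -- Over a field conjugation preserves the trace, so the one remaining diagonal entry vanishes
    -- too.
    have htr : B.trace = 0 := by
      obtain ⟨U, hU⟩ := hB
      have : B = U * A * (U⁻¹ : (Matrix (Fin n) (Fin n) K)ˣ) := by
        rw [hU.eq, mul_assoc, Units.mul_inv, mul_one]
      rw [this, trace_mul_comm, ← mul_assoc, Units.inv_mul, one_mul, hA]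
    have hBi : B i i = 0 := by
      rwa [trace, Finset.sum_eq_single i (fun j hj hji => by simpa using hi j hj hji) (by simp)] at htr
    refine (isAddCommutator_of_diag_zero (fun i => ⟨f i, Subring.mem_center_iff.2 fun g => mul_comm _ _⟩)
      (fun a b hab => hf (congrArg Subtype.val hab)) B fun j => ?_).of_isConj hB.symm
    by_cases hj : j = i
    · rw [hj, hBi]
    · exact hi j (Finset.mem_univ j) hj

/-- Over a field with at least three elements, every nonzero element is a sum of `n + 1` nonzero
elements. -/
theorem exists_ne_zero_sum_eq {K : Type*} [Field K] {u : K} (hu0 : u ≠ 0) (hu1 : u ≠ 1) (n : ℕ) :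
    ∀ x : K, x ≠ 0 → ∃ β : Fin (n + 1) → K, (∀ i, β i ≠ 0) ∧ ∑ i, β i = x := by
  induction n with
  | zero => exact fun x hx => ⟨fun _ => x, fun _ => hx, by simp⟩
  | succ n ih =>
    intro x hx
    -- Split x = x * u + x * (1 - u), both summands nonzero.
    obtain ⟨β, hβ, hs⟩ := ih (x - x * u) (by
      rw [← mul_one_sub]; exact mul_ne_zero hx (sub_ne_zero.2 hu1.symm))
    refine ⟨Fin.cons (x * u) β, fun i => ?_, by simp [Fin.sum_univ_succ, hs]⟩
    refine Fin.cases ?_ (fun j => ?_) i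
    · simpa using mul_ne_zero hx hu0
    · simpa using hβ j

theorem exists_ne_zero_sum_eq_zero {K : Type*} [Field K] {u : K} (hu0 : u ≠ 0) (hu1 : u ≠ 1) {n : ℕ}
    (hn : 2 ≤ n) : ∃ β : Fin n → K, (∀ i, β i ≠ 0) ∧ ∑ i, β i = 0 := by
  obtain ⟨m, rfl⟩ := Nat.exists_eq_add_of_le' hn
  obtain ⟨β, hβ, hs⟩ := exists_ne_zero_sum_eq hu0 hu1 m (-1) (by simp)
  refine ⟨Fin.cons 1 β, fun i => ?_, by simp [Fin.sum_univ_succ, hs]⟩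
  refine Fin.cases ?_ (fun j => ?_) i
  · simp
  · simpa using hβ j

/-! ### Factorizations with an invertible commutator -/

/-- Products of two commutators with invertible first factor. -/
def IsMulAddCommutator [Ring R] (A : Matrix ι ι R) : Prop :=
  ∃ B C : Matrix ι ι R, IsUnit B ∧ B.IsAddCommutator ∧ C.IsAddCommutator ∧ A = B * C

theorem IsMulAddCommutator.of_isConj [Ring R] {A B : Matrix ι ι R} (h : IsConj A B)
    (hA : A.IsMulAddCommutator) : B.IsMulAddCommutator := by
  obtain ⟨U, hU⟩ := h
  obtain ⟨S, T, hS, hS', hT, rfl⟩ := hA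
  have hc : ∀ M : Matrix ι ι R, IsConj M (U * M * (U⁻¹ : (Matrix ι ι R)ˣ)) :=
    fun M => ⟨U, by simp [SemiconjBy]⟩
  refine ⟨U * S * (U⁻¹ : (Matrix ι ι R)ˣ), U * T * (U⁻¹ : (Matrix ι ι R)ˣ),
    (U.isUnit.mul hS).mul (U⁻¹).isUnit, hS'.of_isConj (hc S), hT.of_isConj (hc T), ?_⟩
  have hB : B = U * (S * T) * (U⁻¹ : (Matrix ι ι R)ˣ) := by
    rw [hU.eq, mul_assoc, Units.mul_inv, mul_one]
  rw [hB]
  simp [mul_assoc]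

variable {n : ℕ}

theorem isMulAddCommutator_of_isScalarOn_univ (hn : 2 ≤ n) (f : Fin n → Subring.center D)
    (hf : Function.Injective f) (A : Matrix (Fin n) (Fin n) D) (hA : A.IsScalarOn Finset.univ) :
    A.IsMulAddCommutator := by
  obtain ⟨c, -, hc⟩ := hA
  obtain ⟨σ, hσ⟩ : ∃ σ : Equiv.Perm (Fin n), ∀ i, σ i ≠ i := by
    obtain ⟨m, rfl⟩ := Nat.exists_eq_add_of_le' hn
    exact ⟨finRotate _, fun i h => by simp at h⟩
  let P : Matrix (Fin n) (Fin n) D := of fun i j => if σ i = j then 1 else 0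
  let Q : Matrix (Fin n) (Fin n) D := of fun i j => if i = σ j then 1 else 0
  have hPQ : P * Q = 1 := by
    ext i j
    simp [P, Q, mul_apply, one_apply]
  have hQP : Q * P = 1 := by
    ext i j
    rw [mul_apply, Finset.sum_eq_single (σ.symm i)]
    · simp [P, Q, one_apply]
    · intro k _ hk
      simp [Q, show i ≠ σ k from fun h => hk (by simp [h])]
    · simp
  refine ⟨P, Q * A, ⟨⟨P, Q, hPQ, hQP⟩, rfl⟩, isAddCommutator_of_diag_zero f hf _ fun i => ?_,
    isAddCommutator_of_diag_zero f hf _ fun i => ?_, by rw [← mul_assoc, hPQ, one_mul]⟩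
  · simp [P, hσ i]
  · rw [mul_apply]
    refine Finset.sum_eq_zero fun j _ => ?_
    by_cases hj : j = i
    · subst hj
      simp [Q, (hσ j).symm]
    · rw [hc j (Finset.mem_univ _) i (Finset.mem_univ _), if_neg hj, mul_zero]

/-- For central s this is a trace zero matrix over the center. A diagonal conjugation turns s = 1
into any nonzero s. -/
theorem isAddCommutator_diagonal_add_single (f : Fin n → Subring.center D)
    (hf : Function.Injective f) (β : Fin n → Subring.center D) (hβ : ∑ i, β i = 0) {i j : Fin n}
    (hij : i ≠ j) (s : D) :
    (diagonal (fun a => (β a : D)) + single i j s).IsAddCommutator := by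
  have hn : 0 < n := i.pos
  have key : ∀ e : Subring.center D,
      (diagonal (fun a => (β a : D)) + single i j (e : D)).IsAddCommutator := by
    intro e
    have := (isAddCommutator_of_trace_eq_zero hn f hf (diagonal β + single i j e)
      (by rw [trace_add, trace_diagonal, hβ, trace_single_eq_of_ne _ _ _ hij, add_zero])).map
      (Subring.center D).subtype
    convert this using 1
    ext a b
    simp only [add_apply, map_apply, diagonal_apply, single_apply, map_add]
    split_ifs <;> simp
  by_cases hs : s = 0
  · simpa [hs] using key 0
  refine (key 1).of_isConj ⟨⟨diagonal (Function.update 1 i s), diagonal (Function.update 1 i s⁻¹),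
    ?_, ?_⟩, ?_⟩
  · rw [diagonal_mul_diagonal, ← diagonal_one]
    congr 1
    ext a
    by_cases ha : a = i
    · subst ha; simp [hs]
    · simp [ha]
  · rw [diagonal_mul_diagonal, ← diagonal_one]
    congr 1
    ext a
    by_cases ha : a = i
    · subst ha; simp [hs]
    · simp [ha]
  · rw [SemiconjBy]
    ext a b
    simp only [diagonal_mul, mul_diagonal, add_apply, diagonal_apply, single_apply]
    by_cases ha : a = i
    · subst ha
      by_cases hb : a = b
      · subst hb
        simp [hij.symm, Subring.mem_center_iff.1 (β a).2 s]
      · by_cases hjb : j = b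
        · subst hjb
          simp [hb, Ne.symm hb]
        · simp [hb, hjb]
    · by_cases hb : a = b
      · subst hb
        simp [ha, Ne.symm ha]
      · simp [hb, Ne.symm ha]

/-- Adding s times row k to row i empties the diagonal, and rescaling rows by the inverses of β
keeps it empty. The inverse operation is the diagonal of β plus one off-diagonal entry, a
commutator. -/
theorem isMulAddCommutator_of_add_mul_eq_zero (f : Fin n → Subring.center D)
    (hf : Function.Injective f) (β : Fin n → Subring.center D) (hβ : ∑ i, β i = 0)
    (hβ0 : ∀ i, β i ≠ 0) (A : Matrix (Fin n) (Fin n) D) {i k : Fin n} (hik : i ≠ k)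
    (hA : ∀ j, j ≠ i → A j j = 0) {s : D} (hs : A i i + s * A k i = 0) :
    A.IsMulAddCommutator := by
  have hβ0' : ∀ i, (β i : D) ≠ 0 := fun i h => hβ0 i (Subtype.ext h)
  have h0 : single i k s * single i k s = 0 := single_mul_single_of_ne _ _ _ _ hik.symm _
  have h1 : (1 - single i k s) * (1 + single i k s) = 1 := by noncomm_ring; simp [h0]
  have h2 : (1 + single i k s) * (1 - single i k s) = 1 := by noncomm_ring; simp [h0]
  have h3 : diagonal (fun a => (β a : D)) * diagonal (fun a => (β a : D)⁻¹) = 1 := by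
    rw [diagonal_mul_diagonal, ← diagonal_one]
    congr 1; ext a; simp [hβ0' a]
  have h4 : diagonal (fun a => (β a : D)⁻¹) * diagonal (fun a => (β a : D)) = 1 := by
    rw [diagonal_mul_diagonal, ← diagonal_one]
    congr 1; ext a; simp [hβ0' a]
  refine ⟨(1 - single i k s) * diagonal (fun a => (β a : D)),
    diagonal (fun a => (β a : D)⁻¹) * ((1 + single i k s) * A), ?_, ?_, ?_, ?_⟩
  · exact IsUnit.mul ⟨⟨_, _, h1, h2⟩, rfl⟩ ⟨⟨_, _, h3, h4⟩, rfl⟩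
  · convert isAddCommutator_diagonal_add_single f hf β hβ hik (-(s * β k)) using 1
    rw [sub_mul, one_mul, sub_eq_add_neg]
    congr 1
    ext a b
    simp only [neg_apply, mul_diagonal, single_apply]
    split_ifs with h
    · rw [h.2]
    · simp
  · refine isAddCommutator_of_diag_zero f hf _ fun j => ?_
    rw [diagonal_mul, add_mul, one_mul, add_apply]
    by_cases hj : j = i
    · subst hj
      rw [single_mul_apply_same, hs, mul_zero]
    · rw [hA j hj, single_mul_apply_of_ne _ _ _ _ _ hj]
      simp
  · rw [mul_assoc, ← mul_assoc (diagonal _) (diagonal _), h3, one_mul, ← mul_assoc, h1, one_mul]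

/-- The block `[[x, 1], [1, y]]` on the indices `i`, `k`, bordered by an identity matrix. -/
def borderedBlock [Ring R] (i k : ι) (x y : R) : Matrix ι ι R :=
  diagonal (fun a => if a = i then x else if a = k then y else 1) + single i k 1 + single k i 1

theorem borderedBlock_mul [Ring R] {i k : ι} (hik : i ≠ k) (x : R) :
    borderedBlock i k x 0 * borderedBlock i k 0 (-x) = 1 := by
  simp only [borderedBlock, add_mul, mul_add, diagonal_mul_diagonal, single_mul_single_same,
    single_mul_single_of_ne _ _ _ _ hik, single_mul_single_of_ne _ _ _ _ hik.symm]
  ext a b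
  simp only [add_apply, diagonal_mul, mul_diagonal, diagonal_apply, single_apply, one_apply]
  by_cases ha : a = i
  · subst ha
    by_cases hb : a = b
    · subst hb; simp [hik.symm]
    · by_cases hkb : k = b
      · subst hkb; simp [hik.symm]
      · simp [hb, hkb, hik.symm]
  · by_cases hk : a = k
    · subst hk
      by_cases hb : a = b
      · subst hb; simp [hik, hik.symm]
      · by_cases hib : i = b
        · subst hib; simp [hik, hik.symm]
        · simp [hb, hib, hik]
    · simp [ha, hk, Ne.symm ha, Ne.symm hk]

omit [Fintype ι] in
theorem borderedBlock_comm [Ring R] {i k : ι} (hik : i ≠ k) (x y : R) :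
    borderedBlock i k x y = borderedBlock k i y x := by
  rw [borderedBlock, borderedBlock, add_right_comm]
  congr 3
  ext a
  split_ifs <;> simp_all

theorem trace_borderedBlock [Ring R] {i k : ι} (hik : i ≠ k) (x y : R) :
    (borderedBlock i k x y).trace = Fintype.card ι - 2 + x + y := by
  have h : ∀ a, (if a = i then x else if a = k then y else 1) =
      1 + (if a = i then x - 1 else 0) + (if a = k then y - 1 else 0) := by
    intro a
    by_cases ha : a = i
    · subst ha; simp [hik]
    · by_cases hk : a = k <;> simp [ha, hk, hik.symm]
  rw [borderedBlock, trace_add, trace_add, trace_diagonal, trace_single_eq_of_ne _ _ _ hik,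
    trace_single_eq_of_ne _ _ _ hik.symm]
  simp only [h, Finset.sum_add_distrib, Finset.sum_ite_eq', Finset.mem_univ, if_true]
  simp only [Finset.sum_const, Finset.card_univ, nsmul_eq_mul, mul_one, add_zero]
  rw [show (2 : R) = 1 + 1 by norm_num]
  abel

/-- The inverse block [[0, 1], [1, -x]] places A k i at (i, i) and A i k - x * A k k at (k, k), all
zero here. -/
theorem isMulAddCommutator_of_row_of_col_eq_zero (f : Fin n → Subring.center D)
    (hf : Function.Injective f) (A : Matrix (Fin n) (Fin n) D) {i k : Fin n} (hik : i ≠ k)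
    (hA : ∀ j, j ≠ i → A j j = 0) (hki : A k i = 0) (hAik : A i k = 0) :
    A.IsMulAddCommutator := by
  -- Makes the trace n - 2 + x of the first factor vanish.
  let x : Subring.center D := 2 - n
  have h1 := borderedBlock_mul hik (x : D)
  have h2 : borderedBlock i k 0 (-(x : D)) * borderedBlock i k (x : D) 0 = 1 := by
    rw [borderedBlock_comm hik, borderedBlock_comm hik]
    simpa using borderedBlock_mul hik.symm (-(x : D))
  refine ⟨borderedBlock i k (x : D) 0, borderedBlock i k 0 (-(x : D)) * A,
    ⟨⟨_, _, h1, h2⟩, rfl⟩, ?_, isAddCommutator_of_diag_zero f hf _ fun j => ?_,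
    by rw [← mul_assoc, h1, one_mul]⟩
  · convert (isAddCommutator_of_trace_eq_zero i.pos f hf (borderedBlock i k x 0)
      (by rw [trace_borderedBlock hik]; simp [x])).map (Subring.center D).subtype using 1
    ext a b
    simp only [borderedBlock, add_apply, map_apply, diagonal_apply, single_apply, map_add]
    split_ifs <;> simp
  · rw [borderedBlock, add_mul, add_mul, add_apply, add_apply, diagonal_mul]
    by_cases hj : j = i
    · subst hj
      rw [single_mul_apply_same, single_mul_apply_of_ne _ _ _ _ _ hik, hki]
      simp
    · rw [hA j hj, single_mul_apply_of_ne _ _ _ _ _ hj]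
      by_cases hk : j = k
      · subst hk
        simp [hAik]
      · simp [single_mul_apply_of_ne _ _ _ _ _ hk]

theorem isMulAddCommutator (hn : 2 ≤ n) (f : Fin n → Subring.center D)
    (hf : Function.Injective f) {u : Subring.center D} (hu0 : u ≠ 0) (hu1 : u ≠ 1)
    (A : Matrix (Fin n) (Fin n) D) : A.IsMulAddCommutator := by
  by_cases hsc : A.IsScalarOn Finset.univ
  · exact isMulAddCommutator_of_isScalarOn_univ hn f hf A hsc
  obtain ⟨B, hB, -, i, -, hi⟩ := exists_isConj_diag_zero_off Finset.univ
    ⟨⟨0, by omega⟩, Finset.mem_univ _⟩ A fun _ => hsc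
  replace hi := fun j => hi j (Finset.mem_univ j)
  refine IsMulAddCommutator.of_isConj hB.symm ?_
  obtain ⟨β, hβ0, hβ⟩ := exists_ne_zero_sum_eq_zero hu0 hu1 hn
  by_cases h : ∃ k, i ≠ k ∧ ∃ s, B i i + s * B k i = 0
  · obtain ⟨k, hik, s, hs⟩ := h
    exact isMulAddCommutator_of_add_mul_eq_zero f hf β hβ hβ0 B hik hi hs
  push Not at h
  have : Nontrivial (Fin n) := Fin.nontrivial_iff_two_le.2 hn
  obtain ⟨k, hk⟩ := exists_ne i
  have hd : B i i ≠ 0 := by simpa using h k hk.symm 0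
  -- A nonzero B k i would let s be solved for.
  have hcol : ∀ k, k ≠ i → B k i = 0 := by
    intro k hk
    by_contra hne
    exact h k hk.symm (-(B i i * (B k i)⁻¹)) (by simp [hne])
  -- This t solves B i k - B i i * t = 0; the zeros of column i keep the rest of the diagonal zero.
  obtain ⟨C, hC, hCe⟩ := exists_isConj_elementary B hk.symm ((B i i)⁻¹ * B i k)
  refine IsMulAddCommutator.of_isConj hC.symm
    (isMulAddCommutator_of_row_of_col_eq_zero f hf C hk.symm (fun j hj => ?_) ?_ ?_)
  · simp [hCe, hj, hi j hj, hcol j hj]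
  · simp [hCe, hk, hk.symm, hcol k hk]
  · simp [hCe, hd, hi k hk, hcol k hk]

end Matrix

theorem theorem3p3 {D : Type*} [DivisionRing D] [Finite (Subring.center D)]
    (q n : ℕ) (hq : Nat.card (Subring.center D) = q) (hn : 2 ≤ n) (hqn : n < q)
    (A : Matrix (Fin n) (Fin n) D) :
    ∃ X Y Z W : Matrix (Fin n) (Fin n) D,
      IsUnit (X * Y - Y * X) ∧ A = (X * Y - Y * X) * (Z * W - W * Z) := by
  subst hq
  have e := Finite.equivFin (Subring.center D)
  -- The center has more than two elements because 2 ≤ n < q.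
  have hu : ∃ u : Subring.center D, u ≠ 0 ∧ u ≠ 1 := by
    by_contra! hu
    have : Nat.card (Subring.center D) ≤ Nat.card (Fin 2) :=
      Nat.card_le_card_of_surjective (fun i : Fin 2 => if i = 0 then (0 : Subring.center D) else 1)
        fun u => by
          by_cases h : u = 0
          · exact ⟨0, by simp [h]⟩
          · exact ⟨1, by simp [hu u h]⟩
    rw [Nat.card_fin] at this
    omega
  obtain ⟨u, hu0, hu1⟩ := hu
  obtain ⟨-, -, hB, ⟨X, Y, rfl⟩, ⟨Z, W, rfl⟩, hA⟩ := Matrix.isMulAddCommutator hn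
    (fun i => e.symm (Fin.castLE hqn.le i))
    (e.symm.injective.comp (Fin.castLE_injective hqn.le)) hu0 hu1 A
  exact ⟨X, Y, Z, W, hB, hA⟩
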